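/- Define a sequence by $a_0 = 0$ and $a_t = \frac{t}{2t+1}(1-a_{t-1}) + a_{t-1}$ for $t \ge 1$. Call a finite, simple, connected graph $G$ a bridgeless cubic graph if every vertex has degree $3$ and no edge of $G$ is a bridge. For such a graph $G$ with edge set $E(G)$ and an integer $t \ge 0$, let $$m_t(G) = \max_{M_1,\dots,M_t} \frac{|M_1 \cup \dots \cup M_t|}{|E(G)|},$$ where the maximum is over all $t$-tuples of (not necessarily distinct) perfect matchings of $G$, regarded as sets of edges, and let $m_t = \inf_G m_t(G)$, where the infimum is over all bridgeless cubic graphs $G$. Then $m_t \ge a_t$ for every integer $t \ge 0$. In particular, every bridgeless cubic graph $G$ has $t$ (not necessarily distinct) perfect matchings whose union contains at least $a_t\,|E(G)|$ edges. -/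

import Mathlib

namespace CubicCover

/-- A (simple) graph on a finite vertex type is a bridgeless cubic graph: it is connected,
every vertex has exactly three neighbours, and no edge is a bridge. -/
structure IsBridgelessCubic {V : Type*} [Finite V] (G : SimpleGraph V) : Prop where
  connected : G.Connected
  cubic : ∀ v : V, (G.neighborSet v).ncard = 3
  bridgeless : ∀ e ∈ G.edgeSet, ¬ G.IsBridge e

/-- The fraction `|M₁ ∪ ⋯ ∪ Mₜ| / |E(G)|` of the edges of `G` that lie in at least one of the
subgraphs `M₁, …, Mₜ`. -/
noncomputable def coveredFraction {V : Type*} {G : SimpleGraph V} {t : ℕ}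
    (M : Fin t → G.Subgraph) : ℝ :=
  ((⋃ i, (M i).edgeSet).ncard : ℝ) / (G.edgeSet.ncard : ℝ)

/-- `m_t(G)`: the maximum of `|M₁ ∪ ⋯ ∪ Mₜ| / |E(G)|` over all families of `t` perfect matchings
of `G` (repetitions are allowed). -/
noncomputable def maxFraction {V : Type*} (G : SimpleGraph V) (t : ℕ) : ℝ :=
  sSup {x : ℝ | ∃ M : Fin t → G.Subgraph,
    (∀ i, (M i).IsPerfectMatching) ∧ x = coveredFraction M}

/-- `m_t`: the infimum of `m_t(G)` over all bridgeless cubic graphs `G`. -/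
noncomputable def m (t : ℕ) : ℝ :=
  sInf {x : ℝ | ∃ (V : Type) (_ : Finite V) (G : SimpleGraph V),
    IsBridgelessCubic G ∧ x = maxFraction G t}

/-- The sequence `a_0 = 0`, `a_t = t / (2 t + 1) * (1 - a_{t-1}) + a_{t-1}` for `t ≥ 1`. -/
noncomputable def a : ℕ → ℝ
  | 0 => 0
  | t + 1 => ((t + 1 : ℕ) : ℝ) / (2 * ((t + 1 : ℕ) : ℝ) + 1) * (1 - a t) + a t

end CubicCover

set_option linter.unusedSectionVars false

/-! Matchings are chosen greedily while a fractional perfect matching is maintained. After `t` of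
them, give each edge the weight `t + 1` minus the number of chosen matchings containing it. The
invariant: this weight divided by `2t + 3` lies in the perfect matching polytope. Uncovered edges
have weight `t + 1`, so some perfect matching covers at least `(t+1)/(2t+3)` of them, which is the
recursion for `a`. The invariant persists if that matching also meets each tight odd cut once
(`isFractional_add_adj_sub`).

The required form of Edmonds' theorem is `exists_tightMatching_le`. Tutte's theorem gives a matching
through any support edge; contracting the two sides of a nontrivial tight odd cut and gluing makes
it tight (`exists_tightMatching_of_pos`). Subtracting the largest admissible multiple of such a
matching kills a support edge or makes another odd cut tight, which drives an induction.

Matchings are involutions of the vertices, and sums run over ordered pairs. -/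

namespace CubicCover

open Finset

/-! ### Cuts and fractional perfect matchings -/

section

variable {V : Type*} [Fintype V] [DecidableEq V]

/-- The total weight of the pairs leading from `X` to its complement. -/
def cut {R : Type*} [AddCommMonoid R] (w : V → V → R) (X : Finset V) : R :=
  ∑ a ∈ X, ∑ b ∈ Xᶜ, w a b

/-- The adjacency matrix of a map. -/
def graphMatrix (R : Type*) [Zero R] [One R] (M : V → V) (a b : V) : R :=
  if M a = b then 1 else 0

/-- `w` is `r` times a point of the perfect matching polytope, in Edmonds' description. -/
structure IsFractional (r : ℝ) (w : V → V → ℝ) : Prop where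
  symm : ∀ a b, w a b = w b a
  nonneg : ∀ a b, 0 ≤ w a b
  diag : ∀ a, w a a = 0
  deg : ∀ a, ∑ b, w a b = r
  odd_cut : ∀ X : Finset V, Odd #X → r ≤ cut w X

/-- `M` is a perfect matching in the support of `w`. -/
structure IsMatchingIn (w : V → V → ℝ) (M : V → V) : Prop where
  invol : ∀ a, M (M a) = a
  pos : ∀ a, 0 < w a (M a)

/-- `M` is a perfect matching in the support of `w` which meets each tight odd cut once. -/
structure IsTightMatching (r : ℝ) (w : V → V → ℝ) (M : V → V) : Prop extends
    IsMatchingIn w M where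
  tight : ∀ X : Finset V, Odd #X → cut w X = r → cut (graphMatrix ℝ M) X = 1

theorem cut_eq_sum_ite {R : Type*} [AddCommMonoid R] (w : V → V → R) (X : Finset V) :
    cut w X = ∑ a, ∑ b, if a ∈ X ∧ b ∉ X then w a b else 0 := by
  unfold cut
  rw [← Finset.sum_subset (subset_univ X) (fun a _ ha => by simp [ha])]
  refine sum_congr rfl fun a ha => ?_
  rw [← Finset.sum_subset (subset_univ Xᶜ) (fun b _ hb => by
    have : b ∈ X := by simpa using hb
    simp [this])]
  exact sum_congr rfl fun b hb => by simp [ha, mem_compl.1 hb]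

theorem cut_add {R : Type*} [AddCommMonoid R] (w w' : V → V → R) (X : Finset V) :
    cut (fun a b => w a b + w' a b) X = cut w X + cut w' X := by
  simp [cut, sum_add_distrib]

theorem cut_sub {R : Type*} [AddCommGroup R] (w w' : V → V → R) (X : Finset V) :
    cut (fun a b => w a b - w' a b) X = cut w X - cut w' X := by
  simp [cut, sum_sub_distrib]

theorem cut_mul_left (c : ℝ) (w : V → V → ℝ) (X : Finset V) :
    cut (fun a b => c * w a b) X = c * cut w X := by
  simp [cut, mul_sum]

theorem cut_intCast (w : V → V → ℤ) (X : Finset V) :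
    cut (fun a b => (w a b : ℝ)) X = (cut w X : ℤ) := by
  simp [cut]

theorem cut_compl {R : Type*} [AddCommMonoid R] {w : V → V → R} (hw : ∀ a b, w a b = w b a)
    (X : Finset V) : cut w Xᶜ = cut w X := by
  unfold cut
  rw [sum_comm, compl_compl]
  exact sum_congr rfl fun a _ => sum_congr rfl fun b _ => hw _ _

theorem cut_singleton {R : Type*} [AddCommGroup R] {w : V → V → R} {v : V} (hw : w v v = 0) :
    cut w {v} = ∑ b, w v b := by
  unfold cut
  rw [sum_singleton, ← sum_add_sum_compl {v} (w v)]
  simp [hw]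

/-- Edges between `Z \ X` and `X \ Z` cross both sets but neither their intersection nor their
union. This is submodularity with its exact defect, used for uncrossing. -/
theorem cut_inter_add_cut_union {w : V → V → ℝ} (hw : ∀ a b, w a b = w b a) (Z X : Finset V) :
    cut w (Z ∩ X) + cut w (Z ∪ X) + 2 * ∑ a ∈ Z \ X, ∑ b ∈ X \ Z, w a b = cut w Z + cut w X := by
  have h1 : ∑ a ∈ Z \ X, ∑ b ∈ X \ Z, w a b =
      ∑ a, ∑ b, if a ∈ Z \ X ∧ b ∈ X \ Z then w a b else 0 := by
    simp_rw [ite_and, Finset.sum_ite_irrel, sum_const_zero, Finset.sum_ite_mem, univ_inter]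
  have h2 : ∑ a ∈ Z \ X, ∑ b ∈ X \ Z, w a b =
      ∑ a, ∑ b, if b ∈ Z \ X ∧ a ∈ X \ Z then w a b else 0 := by
    rw [h1, sum_comm]
    exact sum_congr rfl fun a _ => sum_congr rfl fun b _ => by rw [hw]
  -- The cuts of `Z` and `X` see such an edge in opposite orientations; one copy of each makes the
  -- identity hold term by term.
  rw [two_mul]
  nth_rw 1 [h1]
  rw [h2]
  simp only [cut_eq_sum_ite, ← sum_add_distrib]
  refine sum_congr rfl fun a _ => sum_congr rfl fun b _ => ?_
  by_cases h1 : a ∈ Z <;> by_cases h2 : a ∈ X <;> by_cases h3 : b ∈ Z <;> by_cases h4 : b ∈ X <;>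
    simp [h1, h2, h3, h4]

theorem cut_graphMatrix (R : Type*) [AddCommMonoidWithOne R] (M : V → V) (X : Finset V) :
    cut (graphMatrix R M) X = ∑ a ∈ X, if M a ∈ X then 0 else 1 := by
  unfold cut graphMatrix
  refine sum_congr rfl fun a _ => ?_
  by_cases h : M a ∈ X <;> simp [h]

theorem graphMatrix_comm (R : Type*) [Zero R] [One R] {M : V → V} (hM : ∀ a, M (M a) = a)
    (a b : V) : graphMatrix R M a b = graphMatrix R M b a := by
  unfold graphMatrix
  congr 1
  exact propext ⟨fun h => by rw [← h, hM], fun h => by rw [← h, hM]⟩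

namespace IsFractional

variable {r : ℝ} {w : V → V → ℝ}

theorem cut_singleton (hw : IsFractional r w) (v : V) : cut w {v} = r := by
  rw [CubicCover.cut_singleton (hw.diag v), hw.deg]

theorem cut_compl (hw : IsFractional r w) (X : Finset V) : cut w Xᶜ = cut w X :=
  CubicCover.cut_compl hw.symm X

theorem le_radius (hw : IsFractional r w) (a b : V) : w a b ≤ r := by
  rw [← hw.deg a]
  exact single_le_sum (f := w a) (fun c _ => hw.nonneg a c) (mem_univ b)

theorem even_card (hw : IsFractional r w) (hr : 0 < r) : Even (Fintype.card V) := by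
  by_contra h
  have := hw.odd_cut univ (by simpa using h)
  simp [cut] at this
  linarith

theorem odd_compl (hw : IsFractional r w) (hr : 0 < r) {X : Finset V} (hX : Odd #X) :
    Odd #Xᶜ := by
  have h := card_add_card_compl X
  have h2 := hw.even_card hr
  rw [← h, Nat.even_add'] at h2
  exact h2.1 hX

end IsFractional

theorem IsMatchingIn.ne {r : ℝ} {w : V → V → ℝ} {M : V → V} (hM : IsMatchingIn w M)
    (hw : IsFractional r w) (a : V) : M a ≠ a := fun h => by
  have := hM.pos a
  rw [h, hw.diag] at this
  exact this.false

/-! ### Contracting odd sets -/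

section Push

variable {U : Type*} [Fintype U] [DecidableEq U]

/-- The weights on the quotient obtained by contracting each fibre of `f` to one point. -/
def push (f : V → U) (w : V → V → ℝ) (p q : U) : ℝ :=
  if p = q then 0 else ∑ a with f a = p, ∑ b with f b = q, w a b

theorem cut_push (f : V → U) (w : V → V → ℝ) (Y : Finset U) :
    cut (push f w) Y = cut w {a | f a ∈ Y} := by
  have h1 : ∀ p ∈ Y, ∑ q ∈ Yᶜ, push f w p q =
      ∑ a with f a = p, ∑ b ∈ ({a | f a ∈ Y} : Finset V)ᶜ, w a b := by
    intro p hp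
    have h : ∀ q ∈ Yᶜ, push f w p q = ∑ a with f a = p, ∑ b with f b = q, w a b := fun q hq =>
      if_neg fun (h : p = q) => mem_compl.1 hq (h ▸ hp)
    rw [sum_congr rfl h, sum_comm]
    refine sum_congr rfl fun a _ => ?_
    rw [← sum_fiberwise_of_maps_to (t := Yᶜ) (g := f) (by simp)]
    refine sum_congr rfl fun q hq => sum_congr ?_ fun _ _ => rfl
    ext b
    simp only [mem_filter, mem_univ, true_and, mem_compl] at hq ⊢
    exact ⟨fun h => ⟨h ▸ hq, h⟩, fun h => h.2⟩
  unfold cut at *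
  rw [sum_congr rfl h1, ← sum_fiberwise_of_maps_to (s := {a | f a ∈ Y}) (t := Y) (g := f) (by simp)]
  refine sum_congr rfl fun p hp => sum_congr ?_ fun _ _ => rfl
  ext b
  simp only [mem_filter, mem_univ, true_and]
  exact ⟨fun h => ⟨h ▸ hp, h⟩, fun h => h.2⟩

theorem odd_card_preimage {f : V → U} (hf : ∀ p, Odd #{a | f a = p}) {Y : Finset U}
    (hY : Odd #Y) : Odd #{a | f a ∈ Y} := by
  rw [card_eq_sum_card_fiberwise (t := Y) (f := f) (by intro a; simp), odd_sum_iff_odd_card_odd,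
    filter_true_of_mem]
  · exact hY
  · intro p hp
    convert hf p using 2
    ext b
    simp only [mem_filter, mem_univ, true_and]
    exact ⟨fun h => h.2, fun h => ⟨h ▸ hp, h⟩⟩

/-- Odd fibres pull odd sets back to odd sets, so no new odd cut arises; tight fibres give the
degrees. -/
theorem IsFractional.contract {r : ℝ} {w : V → V → ℝ} (hw : IsFractional r w) {f : V → U}
    (hf : ∀ p, Odd #{a | f a = p}) (hf' : ∀ p, cut w {a | f a = p} = r) :
    IsFractional r (push f w) where
  symm p q := by
    unfold push
    rw [sum_comm]
    simp only [eq_comm (a := p), hw.symm]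
  nonneg p q := by
    unfold push
    split_ifs
    · rfl
    · exact sum_nonneg fun _ _ => sum_nonneg fun _ _ => hw.nonneg _ _
  diag p := if_pos rfl
  deg p := by
    rw [← CubicCover.cut_singleton (w := push f w) (if_pos rfl), cut_push, ← hf' p]
    simp
  odd_cut Y hY := by
    rw [cut_push]
    exact hw.odd_cut _ (odd_card_preimage hf hY)

theorem le_push {r : ℝ} {w : V → V → ℝ} (hw : IsFractional r w) (f : V → U) {a b : V}
    (h : f a ≠ f b) : w a b ≤ push f w (f a) (f b) := by
  unfold push
  rw [if_neg h]
  refine le_trans ?_ (single_le_sum (f := fun a => ∑ b' with f b' = f b, w a b')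
    (fun c _ => sum_nonneg fun _ _ => hw.nonneg _ _) (show a ∈ _ by simp))
  exact single_le_sum (f := w a) (fun c _ => hw.nonneg a c) (by simp)

end Push

/-! ### One side of a tight odd cut -/

section Side

variable {r : ℝ} {w : V → V → ℝ}

/-- The map contracting the complement of `S` to one point. -/
def proj (S : Finset V) (a : V) : Option S := if h : a ∈ S then some ⟨a, h⟩ else none

theorem proj_eq_none {S : Finset V} {a : V} : proj S a = none ↔ a ∉ S := by
  unfold proj; split_ifs <;> simpa

theorem proj_eq_some {S : Finset V} {a : V} {b : S} : proj S a = some b ↔ a = b := by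
  unfold proj
  split_ifs with h
  · simp [Subtype.ext_iff]
  · simp only [false_iff]
    rintro rfl
    exact h b.2

theorem proj_eq_proj {S : Finset V} {a b : V} (hb : b ∈ S) : proj S a = proj S b ↔ a = b := by
  have : proj S b = some ⟨b, hb⟩ := proj_eq_some.2 rfl
  rw [this, proj_eq_some]

theorem IsFractional.push_proj (hw : IsFractional r w) {S : Finset V} (hS : Odd #Sᶜ)
    (ht : cut w S = r) : IsFractional r (push (proj S) w) := by
  have h0 : ({a | proj S a = none} : Finset V) = Sᶜ := by ext; simp [proj_eq_none]
  have h1 : ∀ p : S, ({a | proj S a = some p} : Finset V) = {p.1} := by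
    intro p; ext; simp [proj_eq_some]
  refine hw.contract ?_ ?_ <;> rintro (_ | p)
  · rwa [h0]
  · rw [h1]; simp
  · rw [h0, hw.cut_compl, ht]
  · rw [h1, hw.cut_singleton]

/-- The restriction to `S` of a tight matching that has only one edge leaving `S`. -/
structure IsSideMatching (r : ℝ) (w : V → V → ℝ) (S : Finset V) (N : V → V) (b : V) : Prop where
  exit_mem : b ∈ S
  exit : N b ∉ S
  inner : ∀ a ∈ S, a ≠ b → N a ∈ S ∧ N (N a) = a
  pos : ∀ a ∈ S, 0 < w a (N a)
  tight : ∀ Z ⊆ S, Odd #Z → cut w Z = r → cut (graphMatrix ℝ N) Z = 1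

/-- A tight matching of the quotient lifts edge by edge to the support of `w`, the exit edge getting
a genuine endpoint outside `S`. Odd subsets of `S` keep their cuts in the quotient, so tightness
lifts too. -/
theorem exists_sideMatching (hw : IsFractional r w) {S : Finset V} {u v : V} (hu : u ∈ S)
    (huv : 0 < w u v) (ih : ∀ p q, 0 < push (proj S) w p q →
      ∃ M, IsTightMatching r (push (proj S) w) M ∧ M p = q) :
    ∃ N b, IsSideMatching r w S N b ∧ N u = v := by
  have hne : proj S u ≠ proj S v := by
    intro h
    rw [eq_comm, proj_eq_proj hu] at h
    rw [h, hw.diag] at huv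
    exact huv.false
  obtain ⟨M, hM, hMu⟩ := ih _ _ (huv.trans_le (le_push hw (proj S) hne))
  have key : ∀ a, ∃ c, a ∈ S → proj S c = M (proj S a) ∧ 0 < w a c ∧ (a = u → c = v) := by
    intro a
    by_cases hau : a = u
    · exact ⟨v, fun _ => ⟨by rw [hau, hMu], by rwa [hau], fun _ => rfl⟩⟩
    by_cases ha : a ∈ S
    · have h := hM.pos (proj S a)
      unfold push at h
      split_ifs at h with h0
      · exact (h.false).elim
      obtain ⟨a', ha', h⟩ := exists_lt_of_sum_lt (f := fun _ => (0 : ℝ)) (by simpa using h)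
      obtain ⟨c, hc, h⟩ := exists_lt_of_sum_lt (f := fun _ => (0 : ℝ)) (by simpa using h)
      rw [mem_filter, proj_eq_proj ha] at ha'
      rw [mem_filter] at hc
      exact ⟨c, fun _ => ⟨hc.2, ha'.2 ▸ h, fun h => absurd h hau⟩⟩
    · exact ⟨a, fun h => absurd h ha⟩
  choose N hN using key
  obtain ⟨b, hb⟩ : ∃ b : S, M none = some b := by
    cases h : M none with
    | none =>
      have := hM.pos none
      rw [h] at this
      simp [push] at this
    | some b => exact ⟨b, rfl⟩
  have hb' : M (proj S b) = none := by
    rw [proj_eq_some.2 rfl, ← hb, hM.invol]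
  refine ⟨N, b, ⟨b.2, ?_, ?_, fun a ha => (hN a ha).2.1, ?_⟩, (hN u hu).2.2 rfl⟩
  · rw [← proj_eq_none, (hN b b.2).1, hb']
  · intro a ha hab
    have h1 : N a ∈ S := by
      by_contra h
      rw [← proj_eq_none, (hN a ha).1] at h
      apply hab
      rw [← proj_eq_some, ← hb, ← h, hM.invol]
    refine ⟨h1, ?_⟩
    rw [← proj_eq_proj ha, (hN _ h1).1, (hN a ha).1, hM.invol]
  · intro Z hZ hodd hcut
    have hmem : ∀ a, proj S a ∈ Z.image (proj S) ↔ a ∈ Z := by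
      intro a
      rw [mem_image]
      exact ⟨fun ⟨c, hc, h⟩ => ((proj_eq_proj (hZ hc)).1 h.symm) ▸ hc, fun h => ⟨a, h, rfl⟩⟩
    have hinj : Set.InjOn (proj S) Z := fun a _ c hc h => (proj_eq_proj (hZ hc)).1 h
    have := hM.tight (Z.image (proj S)) (by rwa [card_image_of_injOn hinj]) (by
      rw [cut_push]
      simp only [hmem]
      rwa [filter_univ_mem])
    rw [cut_graphMatrix, sum_image hinj] at this
    rw [cut_graphMatrix]
    refine Eq.trans (sum_congr rfl fun a ha => ?_) this
    rw [← (hN a (hZ ha)).1]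
    simp only [hmem]

end Side

end

/-! ### Gluing across a tight odd cut, and counting odd sets -/

section

variable {V : Type*} [Fintype V] [DecidableEq V] {r : ℝ} {w : V → V → ℝ}

/-- Submodularity makes `Z ∩ X` and `Z ∪ X` tight, with no weight between `Z \ X` and `X \ Z`. The
same identity for `M`, which lies in the support, then reduces `Z` to tight sets inside `X` or `Xᶜ`.
-/
theorem cut_graphMatrix_of_uncrossed (hw : IsFractional r w) (hr : 0 < r) {M : V → V}
    (hM : IsMatchingIn w M) {X Z : Finset V} (hX : Odd #X) (hXr : cut w X = r)
    (hin : ∀ Y ⊆ X, Odd #Y → cut w Y = r → cut (graphMatrix ℝ M) Y = 1)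
    (hout : ∀ Y ⊆ Xᶜ, Odd #Y → cut w Y = r → cut (graphMatrix ℝ M) Y = 1)
    (hZ : Odd #Z) (hZr : cut w Z = r) (hZX : Odd #(Z ∩ X)) :
    cut (graphMatrix ℝ M) Z = 1 := by
  have hU : Odd #(Z ∪ X) := by
    have := card_union_add_card_inter Z X
    have h2 : Even (#(Z ∪ X) + #(Z ∩ X)) := this ▸ hZ.add_odd hX
    exact (Nat.even_add'.1 h2).2 hZX
  have e1 := cut_inter_add_cut_union hw.symm Z X
  have e2 := cut_inter_add_cut_union (graphMatrix_comm ℝ hM.invol) Z X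
  have h1 := hw.odd_cut _ hZX
  have h2 := hw.odd_cut _ hU
  have h3 : ∀ a ∈ Z \ X, 0 ≤ ∑ b ∈ X \ Z, w a b := fun a _ => sum_nonneg fun b _ => hw.nonneg a b
  have h4 := sum_nonneg h3
  have h5 : ∑ a ∈ Z \ X, ∑ b ∈ X \ Z, w a b = 0 := by linarith
  have h6 : ∑ a ∈ Z \ X, ∑ b ∈ X \ Z, graphMatrix ℝ M a b = 0 := by
    refine sum_eq_zero fun a ha => sum_eq_zero fun b hb => if_neg fun h => ?_
    have := (sum_eq_zero_iff_of_nonneg fun b _ => hw.nonneg a b).1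
      ((sum_eq_zero_iff_of_nonneg h3).1 h5 a ha) b hb
    have h' := hM.pos a
    rw [h, this] at h'
    exact h'.false
  have h7 := hin _ inter_subset_right hZX (by linarith)
  have h8 := hin X subset_rfl hX hXr
  have h9 := hout (Z ∪ X)ᶜ (compl_subset_compl.2 subset_union_right) (hw.odd_compl hr hU)
    (by rw [hw.cut_compl]; linarith)
  rw [cut_compl (graphMatrix_comm ℝ hM.invol)] at h9
  linarith

theorem exists_tight_of_sides (hw : IsFractional r w) (hr : 0 < r) {X : Finset V} (hX : Odd #X)
    (hXr : cut w X = r) {N N' : V → V} {b b' : V} (hN : IsSideMatching r w X N b)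
    (hN' : IsSideMatching r w Xᶜ N' b') (h : N b = b') (h' : N' b' = b) :
    IsTightMatching r w fun a => if a ∈ X then N a else N' a := by
  have hM : IsMatchingIn w fun a => if a ∈ X then N a else N' a := by
    refine ⟨fun a => ?_, fun a => ?_⟩
    · by_cases ha : a ∈ X
      · by_cases hab : a = b
        · have := hN.exit
          simp only [hab, hN.exit_mem, this, if_true, if_false]
          rw [h, h']
        · simp [ha, hN.inner a ha hab]
      · by_cases hab : a = b'
        · have := mem_compl.1 hN'.exit_mem
          simp only [hab, this, if_false]
          rw [h', if_pos hN.exit_mem, h]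
        · have := hN'.inner a (mem_compl.2 ha) hab
          simp [ha, this, mem_compl.1 this.1]
    · split_ifs with ha
      · exact hN.pos a ha
      · exact hN'.pos a (mem_compl.2 ha)
  have hin : ∀ Y ⊆ X, Odd #Y → cut w Y = r →
      cut (graphMatrix ℝ fun a => if a ∈ X then N a else N' a) Y = 1 := by
    intro Y hY h1 h2
    rw [← hN.tight Y hY h1 h2]
    exact sum_congr rfl fun a ha => sum_congr rfl fun b _ => by simp [graphMatrix, hY ha]
  have hout : ∀ Y ⊆ Xᶜ, Odd #Y → cut w Y = r →
      cut (graphMatrix ℝ fun a => if a ∈ X then N a else N' a) Y = 1 := by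
    intro Y hY h1 h2
    rw [← hN'.tight Y hY h1 h2]
    exact sum_congr rfl fun a ha => sum_congr rfl fun b _ => by
      simp [graphMatrix, mem_compl.1 (hY ha)]
  refine ⟨hM, fun Z hZ hZr => ?_⟩
  by_cases hZX : Odd #(Z ∩ X)
  · exact cut_graphMatrix_of_uncrossed hw hr hM hX hXr hin hout hZ hZr hZX
  -- Now `Z ∩ Xᶜ` is odd, so the two sides swap roles.
  · refine cut_graphMatrix_of_uncrossed hw hr hM (hw.odd_compl hr hX)
      ((hw.cut_compl X).trans hXr) hout (by rwa [compl_compl]) hZ hZr ?_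
    have := card_inter_add_card_sdiff Z X
    rw [← sdiff_eq_inter_compl]
    rw [← this, Nat.odd_add] at hZ
    rw [← Nat.not_even_iff_odd]
    exact fun h => hZX (hZ.2 h)

/-- If a family of disjoint odd sets sends all its weight into `S`, and `S` spans a positive
weight, then the family is smaller than `S`. -/
theorem card_lt_of_disjoint_odd {ι : Type*} (hw : IsFractional r w) (hr : 0 < r)
    (I : Finset ι) (K : ι → Finset V) (S : Finset V) (hodd : ∀ i ∈ I, Odd #(K i))
    (hdisj : (I : Set ι).PairwiseDisjoint K) (hKS : ∀ i ∈ I, Disjoint (K i) S)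
    (hK : ∀ i ∈ I, ∀ a ∈ K i, ∀ b, 0 < w a b → b ∈ K i ∨ b ∈ S) {u v : V} (hu : u ∈ S)
    (hv : v ∈ S) (huv : 0 < w u v) : #I < #S := by
  have h1 : ∀ i ∈ I, r ≤ ∑ a ∈ K i, ∑ b ∈ S, w a b := by
    intro i hi
    refine (hw.odd_cut _ (hodd i hi)).trans (sum_le_sum fun a ha => ?_)
    rw [← sum_filter_add_sum_filter_not (K i)ᶜ (· ∈ S)]
    have : ∑ b ∈ (K i)ᶜ with b ∉ S, w a b = 0 := by
      refine sum_eq_zero fun b hb => ?_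
      rw [mem_filter, mem_compl] at hb
      by_contra hne
      exact (hK i hi a ha b ((hw.nonneg a b).lt_of_ne' hne)).elim hb.1 hb.2
    rw [this, add_zero]
    exact sum_le_sum_of_subset_of_nonneg (fun b hb => (mem_filter.1 hb).2)
      fun b _ _ => hw.nonneg a b
  have h2 : (#I : ℝ) * r ≤ ∑ a ∈ Sᶜ, ∑ b ∈ S, w a b := by
    calc (#I : ℝ) * r = ∑ i ∈ I, r := by simp
      _ ≤ ∑ i ∈ I, ∑ a ∈ K i, ∑ b ∈ S, w a b := sum_le_sum h1
      _ = ∑ a ∈ I.biUnion K, ∑ b ∈ S, w a b := (sum_biUnion hdisj).symm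
      _ ≤ _ := by
        refine sum_le_sum_of_subset_of_nonneg ?_ fun a _ _ => sum_nonneg fun b _ => hw.nonneg a b
        intro a ha
        obtain ⟨i, hi, ha⟩ := mem_biUnion.1 ha
        exact mem_compl.2 (disjoint_left.1 (hKS i hi) ha)
  -- The vertices of `S` have total weight `#S * r`; the part spent inside `S` is at least `w u v`,
  -- whence strictness.
  have h3 : (∑ a ∈ S, ∑ b ∈ S, w a b) + ∑ a ∈ Sᶜ, ∑ b ∈ S, w a b = #S * r := by
    rw [sum_add_sum_compl S, sum_comm, sum_congr rfl fun b _ => ?_, sum_const, nsmul_eq_mul]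
    simp only [hw.symm _ b, hw.deg]
  have h4 : w u v ≤ ∑ a ∈ S, ∑ b ∈ S, w a b :=
    (single_le_sum (f := w u) (fun b _ => hw.nonneg u b) hv).trans
      (single_le_sum (f := fun a => ∑ b ∈ S, w a b)
        (fun a _ => sum_nonneg fun b _ => hw.nonneg a b) hu)
  have h5 : (#I : ℝ) * r < #S * r := by linarith
  exact_mod_cast lt_of_mul_lt_mul_right h5 hr.le

end

/-! ### A tight matching through every support edge -/

section

variable {V : Type*} [Fintype V] [DecidableEq V] {r : ℝ} {w : V → V → ℝ}

/-- The support of `w`, without the vertices `u` and `v`. -/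
def IsFractional.supportMinus (hw : IsFractional r w) (u v : V) :
    SimpleGraph {x : V // x ≠ u ∧ x ≠ v} where
  Adj a b := 0 < w a b
  symm := ⟨fun a b h => by rwa [hw.symm]⟩
  loopless := ⟨fun a h => by rw [hw.diag] at h; exact h.false⟩

/-- By parity a violator leaves at least `S.ncard + 2` odd components. Each sends weight at least
`r` into `S ∪ {u, v}`, which cannot absorb that much since `u v` uses some of its capacity. -/
theorem not_isTutteViolator_supportMinus (hw : IsFractional r w) (hr : 0 < r) {u v : V}
    (huv : 0 < w u v) (S : Set {x : V // x ≠ u ∧ x ≠ v}) :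
    ¬ (hw.supportMinus u v).IsTutteViolator S := by
  classical
  intro hS
  unfold SimpleGraph.IsTutteViolator at hS
  set H := (⊤ : (hw.supportMinus u v).Subgraph).deleteVerts S with hH
  have hne : u ≠ v := by
    rintro rfl
    rw [hw.diag] at huv
    exact huv.false
  have hverts : H.verts = Sᶜ := by simp [hH, Set.compl_eq_univ_sdiff]
  have hnot : ∀ x : H.verts, x.1 ∉ S := fun x => (Set.ext_iff.1 hverts x.1).1 x.2
  have hadj : ∀ x y : H.verts, 0 < w x.1.1 y.1.1 → H.coe.Adj x y := by
    intro x y h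
    exact SimpleGraph.Subgraph.deleteVerts_adj.2 ⟨trivial, hnot x, trivial, hnot y, h⟩
  have hinj : Function.Injective fun x : H.verts => x.1.1 :=
    Subtype.val_injective.comp Subtype.val_injective
  let T : Finset V := S.toFinset.map (Function.Embedding.subtype _)
  have hT : ∀ a, a ∈ T ↔ ∃ s ∈ S, s.1 = a := by intro a; simp [T]
  have hTcard : #({u, v} ∪ T) = S.ncard + 2 := by
    rw [card_union_of_disjoint, card_pair hne, card_map, Set.ncard_eq_toFinset_card', add_comm]
    rw [disjoint_left]
    intro a ha haT
    obtain ⟨s, -, rfl⟩ := (hT a).1 haT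
    have := s.2
    simp at ha
    tauto
  let K : H.coe.ConnectedComponent → Finset V := fun c =>
    c.supp.toFinset.map ⟨fun x => x.1.1, hinj⟩
  have hK : ∀ c a, a ∈ K c ↔ ∃ x ∈ c.supp, x.1.1 = a := by intro c a; simp [K]
  have hlt := card_lt_of_disjoint_odd hw hr H.coe.oddComponents.toFinset K ({u, v} ∪ T)
    (by
      intro c hc
      rw [Set.mem_toFinset] at hc
      rw [card_map, ← Set.ncard_eq_toFinset_card']
      exact hc)
    (by
      intro c _ d _ hcd
      refine (disjoint_map _).2 (Set.disjoint_toFinset.2 ?_)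
      exact H.coe.pairwise_disjoint_supp_connectedComponent hcd)
    (by
      intro c _
      rw [disjoint_left]
      intro a ha ha'
      obtain ⟨x, -, rfl⟩ := (hK c a).1 ha
      rw [mem_union, hT] at ha'
      rcases ha' with ha' | ⟨s, hs, hsx⟩
      · have := x.1.2
        simp at ha'
        tauto
      · exact hnot x (Subtype.ext hsx ▸ hs))
    (by
      intro c _ a ha b hab
      obtain ⟨x, hx, rfl⟩ := (hK c a).1 ha
      by_cases hb : b ∈ ({u, v} : Finset V) ∪ T
      · exact Or.inr hb
      left
      rw [mem_union, hT] at hb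
      push Not at hb
      have hb1 : b ≠ u ∧ b ≠ v := by simpa using hb.1
      let y : H.verts := ⟨⟨b, hb1⟩, by rw [hverts]; exact fun h => hb.2 _ h rfl⟩
      exact (hK c b).2 ⟨y, c.mem_supp_of_adj_mem_supp hx (hadj x y hab), rfl⟩)
    (u := u) (v := v) (by simp) (by simp) huv
  rw [hTcard, ← Set.ncard_eq_toFinset_card'] at hlt
  have hcount : H.coe.oddComponents.ncard = S.ncard + 1 := by omega
  have hpar := H.coe.odd_ncard_oddComponents
  have h1 : Nat.card H.verts = Sᶜ.ncard := by rw [hverts]; rfl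
  have h2 := Set.ncard_add_ncard_compl S
  have h3 : Nat.card {x : V // x ≠ u ∧ x ≠ v} + 2 = Fintype.card V := by
    rw [Nat.card_eq_fintype_card, Fintype.card_subtype, ← card_pair hne,
      ← card_compl_add_card {u, v}]
    congr 2
    ext; simp
  have h4 := hw.even_card hr
  rw [hcount, h1] at hpar
  rw [← h3, ← h2] at h4
  simp only [Nat.even_add, even_two, iff_true, ← Nat.not_even_iff_odd] at hpar h4
  simp at hpar
  rw [← Nat.not_even_iff_odd] at hpar
  tauto

theorem exists_matching_of_pos (hw : IsFractional r w) (hr : 0 < r) {u v : V}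
    (huv : 0 < w u v) : ∃ M, IsMatchingIn w M ∧ M u = v := by
  obtain ⟨P, hP⟩ := SimpleGraph.tutte.2 (not_isTutteViolator_supportMinus hw hr huv)
  have hex := fun x => hP.1 (hP.2 x)
  choose f hf hf' using hex
  have hff : ∀ x, f (f x) = x := fun x => (hf' _ _ (hf x).symm).symm
  have hne : u ≠ v := by
    rintro rfl
    rw [hw.diag] at huv
    exact huv.false
  let M : V → V := fun a =>
    if h : a ≠ u ∧ a ≠ v then f ⟨a, h⟩ else if a = u then v else u
  have h1 : ∀ x : {x : V // x ≠ u ∧ x ≠ v}, M x = f x := fun x => by simp [M, x.2]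
  have h2 : M u = v := by simp [M]
  have h3 : M v = u := by simp [M, hne.symm]
  have hcases : ∀ a, a = u ∨ a = v ∨ ∃ x : {x : V // x ≠ u ∧ x ≠ v}, x = a := by
    intro a
    by_cases h : a = u
    · exact Or.inl h
    by_cases h' : a = v
    · exact Or.inr (Or.inl h')
    exact Or.inr (Or.inr ⟨⟨a, h, h'⟩, rfl⟩)
  refine ⟨M, ⟨fun a => ?_, fun a => ?_⟩, h2⟩
  · obtain rfl | rfl | ⟨x, rfl⟩ := hcases a
    · rw [h2, h3]
    · rw [h3, h2]
    · rw [h1, h1, hff]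
  · obtain rfl | rfl | ⟨x, rfl⟩ := hcases a
    · rwa [h2]
    · rwa [h3, hw.symm]
    · rw [h1]
      exact P.adj_sub (hf x)

/-- If every tight odd cut is trivial, any matching in the support is tight. Otherwise both
contractions along a nontrivial one have fewer vertices. -/
theorem exists_tightMatching_of_pos_aux (n : ℕ) : ∀ {V : Type*} [Fintype V] [DecidableEq V]
    {w : V → V → ℝ}, Fintype.card V = n → IsFractional r w → 0 < r → ∀ {u v : V}, 0 < w u v →
    ∃ M, IsTightMatching r w M ∧ M u = v := by
  induction n using Nat.strong_induction_on with
  | _ n ih =>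
  intro V _ _ w hn hw hr u v huv
  by_cases htriv : ∀ X : Finset V, Odd #X → cut w X = r → #X = 1 ∨ #Xᶜ = 1
  · obtain ⟨M, hM, hMu⟩ := exists_matching_of_pos hw hr huv
    have h1 : ∀ x, cut (graphMatrix ℝ M) {x} = 1 := fun x => by
      rw [cut_graphMatrix]; simp [hM.ne hw]
    refine ⟨M, ⟨hM, fun X hX hXr => ?_⟩, hMu⟩
    rcases htriv X hX hXr with h | h
    · obtain ⟨x, rfl⟩ := card_eq_one.1 h
      exact h1 x
    · obtain ⟨x, hx⟩ := card_eq_one.1 h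
      rw [← cut_compl (graphMatrix_comm ℝ hM.invol), hx, h1]
  have hX : ∃ X : Finset V, Odd #X ∧ cut w X = r ∧ #X ≠ 1 ∧ #Xᶜ ≠ 1 ∧ u ∈ X := by
    push Not at htriv
    obtain ⟨X, h1, h2, h3, h4⟩ := htriv
    by_cases hu : u ∈ X
    · exact ⟨X, h1, h2, h3, h4, hu⟩
    · exact ⟨Xᶜ, hw.odd_compl hr h1, (hw.cut_compl X).trans h2, h4, by rwa [compl_compl],
        mem_compl.2 hu⟩
  obtain ⟨X, hX, hXr, hX1, hX2, hu⟩ := hX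
  have hXc := hw.odd_compl hr hX
  have hXcr := (hw.cut_compl X).trans hXr
  have hcard := card_add_card_compl X
  have step : ∀ S : Finset V, Odd #Sᶜ → cut w S = r → #S + 1 < n → ∀ p q,
      0 < push (proj S) w p q → ∃ M, IsTightMatching r (push (proj S) w) M ∧ M p = q := by
    intro S hS hSr hSn p q hpq
    exact ih _ hSn (by simp) (hw.push_proj hS hSr) hr hpq
  obtain ⟨N, b, hN, hNu⟩ := exists_sideMatching hw hu huv (step X hXc hXr (by
    have := hXc.pos; omega))
  have hbpos := hN.pos b hN.exit_mem
  rw [hw.symm] at hbpos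
  -- The edge by which the first side leaves `X` is prescribed on the second, so the two halves fit.
  obtain ⟨N', b', hN', hNb⟩ := exists_sideMatching hw (mem_compl.2 hN.exit) hbpos
    (step Xᶜ (by rwa [compl_compl]) hXcr (by have := hX.pos; omega))
  have hb' : N b = b' := by
    by_contra h
    have := (hN'.inner _ (mem_compl.2 hN.exit) h).1
    rw [hNb, mem_compl] at this
    exact this hN.exit_mem
  exact ⟨_, exists_tight_of_sides hw hr hX hXr hN hN' hb' (hb' ▸ hNb), by simp [hu, hNu]⟩

theorem exists_tightMatching_of_pos (hw : IsFractional r w) (hr : 0 < r) {u v : V}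
    (huv : 0 < w u v) : ∃ M, IsTightMatching r w M ∧ M u = v :=
  exists_tightMatching_of_pos_aux _ rfl hw hr huv

end

/-! ### Linear functionals on the perfect matching polytope -/

section

variable {V : Type*} [Fintype V] [DecidableEq V] {r : ℝ} {w : V → V → ℝ}

theorem sum_graphMatrix (R : Type*) [NonAssocSemiring R] (M : V → V) (a : V) :
    ∑ b, graphMatrix R M a b = 1 := by
  simp [graphMatrix]

/-- Otherwise `M` would pair off the elements of `X`. -/
theorem one_le_cut_graphMatrix {M : V → V} (hM : ∀ a, M (M a) = a) (hne : ∀ a, M a ≠ a)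
    {X : Finset V} (hX : Odd #X) : 1 ≤ cut (graphMatrix ℝ M) X := by
  have h : ∃ a ∈ X, M a ∉ X := by
    by_contra! h
    rw [← Nat.not_even_iff_odd] at hX
    refine hX (even_iff_two_dvd.2 ?_)
    have : (∑ a ∈ X, (1 : ZMod 2)) = 0 :=
      sum_involution (fun a _ => M a) (fun _ _ => by decide) (fun a _ _ => hne a) h
        fun a _ => hM a
    simpa [ZMod.natCast_eq_zero_iff] using this
  obtain ⟨a, ha, haM⟩ := h
  rw [cut_graphMatrix]
  have := single_le_sum (f := fun a => if M a ∈ X then (0 : ℝ) else 1)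
    (fun a _ => by split_ifs <;> simp) ha
  simpa [haM] using this

/-- The largest multiple of `M` that can be subtracted from `w`. -/
theorem exists_max_step (hw : IsFractional r w) [Nonempty V] {M : V → V}
    (hM : IsTightMatching r w M) :
    ∃ ε, 0 < ε ∧ ε ≤ r ∧ (∀ a, ε ≤ w a (M a)) ∧
      (∀ X, Odd #X → ε * (cut (graphMatrix ℝ M) X - 1) ≤ cut w X - r) ∧
      ((∃ a, w a (M a) = ε) ∨ ∃ X, Odd #X ∧ r < cut w X ∧
        ε * (cut (graphMatrix ℝ M) X - 1) = cut w X - r) := by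
  classical
  -- Only odd cuts met more than once limit the step; as `M` is tight, these have positive slack.
  let 𝒳 : Finset (Finset V) := {X | Odd #X ∧ 1 < cut (graphMatrix ℝ M) X}
  let φ : Finset V → ℝ := fun X => (cut w X - r) / (cut (graphMatrix ℝ M) X - 1)
  let F : Finset ℝ := univ.image (fun a => w a (M a)) ∪ 𝒳.image φ
  have hF : F.Nonempty := (univ_nonempty.image _).mono subset_union_left
  have h𝒳 : ∀ X ∈ 𝒳, Odd #X ∧ 1 < cut (graphMatrix ℝ M) X ∧ r < cut w X := by
    intro X hX
    obtain ⟨h1, h2⟩ : Odd #X ∧ 1 < cut (graphMatrix ℝ M) X := by simpa [𝒳] using hX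
    refine ⟨h1, h2, lt_of_le_of_ne (hw.odd_cut X h1) fun h => ?_⟩
    exact h2.ne' (hM.tight X h1 h.symm)
  have hle : ∀ a, F.min' hF ≤ w a (M a) := fun a =>
    F.min'_le _ (mem_union_left _ (mem_image_of_mem _ (mem_univ a)))
  have hmem := F.min'_mem hF
  refine ⟨F.min' hF, ?_, ?_, hle, ?_, ?_⟩
  · rw [Finset.lt_min'_iff]
    intro x hx
    rcases mem_union.1 hx with hx | hx
    · obtain ⟨a, -, rfl⟩ := mem_image.1 hx
      exact hM.pos a
    · obtain ⟨X, hX, rfl⟩ := mem_image.1 hx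
      obtain ⟨-, h2, h3⟩ := h𝒳 X hX
      exact div_pos (sub_pos.2 h3) (sub_pos.2 h2)
  · obtain ⟨a⟩ := ‹Nonempty V›
    exact (hle a).trans (hw.le_radius _ _)
  · intro X hX
    rcases (one_le_cut_graphMatrix hM.invol (hM.ne hw) hX).eq_or_lt with h | h
    · rw [← h]
      linarith [hw.odd_cut X hX]
    · rw [← le_div_iff₀ (sub_pos.2 h)]
      exact F.min'_le _ (mem_union_right _ (mem_image_of_mem φ (by simp [𝒳, hX, h])))
  · rcases mem_union.1 hmem with hx | hx
    · obtain ⟨a, -, ha⟩ := mem_image.1 hx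
      exact Or.inl ⟨a, ha⟩
    · obtain ⟨X, hX, hXe⟩ := mem_image.1 hx
      obtain ⟨h1, h2, h3⟩ := h𝒳 X hX
      refine Or.inr ⟨X, h1, h3, ?_⟩
      rw [← hXe]
      exact div_mul_cancel₀ _ (sub_pos.2 h2).ne'

/-- The linear functional with coefficients `c` is at least as large on some tight matching as on
the corresponding point of the perfect matching polytope. -/
theorem exists_tightMatching_le [Nonempty V] (c : V → V → ℝ) (hw : IsFractional r w)
    (hr : 0 < r) :
    ∃ M, IsTightMatching r w M ∧ ∑ a, ∑ b, c a b * w a b ≤ r * ∑ a, c a (M a) := by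
  classical
  -- The measure counts support pairs and slack odd cuts.
  obtain ⟨n, hn⟩ : ∃ n, n = #{p : V × V | 0 < w p.1 p.2} +
    #{X : Finset V | Odd #X ∧ r < cut w X} := ⟨_, rfl⟩
  induction n using Nat.strong_induction_on generalizing r w with
  | _ n ih =>
  have hpos : ∃ u v, 0 < w u v := by
    obtain ⟨u⟩ := ‹Nonempty V›
    by_contra! h
    have := hw.deg u
    exact absurd (sum_nonpos fun b _ => h u b) (by rw [this]; exact hr.not_ge)
  obtain ⟨u, v, huv⟩ := hpos
  obtain ⟨M, hM, -⟩ := exists_tightMatching_of_pos hw hr huv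
  by_cases hle : ∑ a, ∑ b, c a b * w a b ≤ r * ∑ a, c a (M a)
  · exact ⟨M, hM, hle⟩
  push Not at hle
  obtain ⟨ε, hε, hεr, hεM, hεX, hmax⟩ := exists_max_step hw hM
  set w' : V → V → ℝ := fun a b => w a b - ε * graphMatrix ℝ M a b with hw'def
  have hcut : ∀ X, cut w' X = cut w X - ε * cut (graphMatrix ℝ M) X := fun X => by
    rw [hw'def, cut_sub, cut_mul_left]
  have hw' : IsFractional (r - ε) w' := by
    refine ⟨fun a b => ?_, fun a b => ?_, fun a => ?_, fun a => ?_, fun X hX => ?_⟩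
    · simp only [hw'def]
      rw [hw.symm, graphMatrix_comm ℝ hM.invol]
    · simp only [hw'def, graphMatrix]
      split_ifs with h
      · subst h
        linarith [hεM a]
      · simpa using hw.nonneg a b
    · simp [hw'def, graphMatrix, hw.diag, hM.ne hw]
    · simp only [hw'def]
      rw [sum_sub_distrib, ← mul_sum, sum_graphMatrix, hw.deg, mul_one]
    · rw [hcut]
      linarith [hεX X hX]
  have hsum : ∑ a, ∑ b, c a b * w' a b = ∑ a, ∑ b, c a b * w a b - ε * ∑ a, c a (M a) := by
    simp only [hw'def, mul_sub, sum_sub_distrib, mul_sum]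
    congr 1
    refine sum_congr rfl fun a _ => ?_
    simp [graphMatrix, mul_comm]
  have hle' : ∀ a b, w' a b ≤ w a b := fun a b => by
    simp only [hw'def, graphMatrix]
    split_ifs <;> simp [hε.le]
  have htight : ∀ X, Odd #X → cut w X = r → cut w' X = r - ε := fun X hX hXr => by
    rw [hcut, hXr, hM.tight X hX hXr, mul_one]
  -- If `ε = r`, nothing remains and `M` attains equality, contrary to `hle`.
  rcases hεr.eq_or_lt with rfl | hεr
  · have h0 : ∀ a b, w' a b = 0 := fun a b => by
      have h1 := hw'.le_radius a b
      have h2 := hw'.nonneg a b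
      linarith
    simp only [h0, mul_zero, sum_const_zero] at hsum
    linarith
  have hsub1 : ({p | 0 < w' p.1 p.2} : Finset (V × V)) ⊆
      ({p | 0 < w p.1 p.2} : Finset (V × V)) := by
    intro p hp
    simp only [mem_filter, mem_univ, true_and] at hp ⊢
    exact hp.trans_le (hle' _ _)
  have hsub2 : ({X | Odd #X ∧ r - ε < cut w' X} : Finset (Finset V)) ⊆
      ({X | Odd #X ∧ r < cut w X} : Finset (Finset V)) := by
    intro X hX
    simp only [mem_filter, mem_univ, true_and] at hX ⊢
    refine ⟨hX.1, lt_of_le_of_ne (hw.odd_cut X hX.1) fun h => ?_⟩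
    exact hX.2.ne' (htight X hX.1 h.symm)
  have hlt : #{p : V × V | 0 < w' p.1 p.2} + #{X : Finset V | Odd #X ∧ r - ε < cut w' X} < n := by
    rw [hn]
    rcases hmax with ⟨a, ha⟩ | ⟨X, hX, hXr, hXe⟩
    · refine add_lt_add_of_lt_of_le (card_lt_card ?_) (card_le_card hsub2)
      refine hsub1.ssubset_of_mem_notMem (a := (a, M a)) ?_ ?_
      · simpa using hM.pos a
      · simp [hw'def, graphMatrix, ha]
    · refine add_lt_add_of_le_of_lt (card_le_card hsub1) (card_lt_card ?_)
      refine hsub2.ssubset_of_mem_notMem (a := X) ?_ ?_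
      · simpa using ⟨hX, hXr⟩
      · intro h
        have := (mem_filter.1 (mem_coe.1 h)).2.2
        rw [hcut] at this
        linarith
  obtain ⟨M', hM', hcM⟩ := ih _ hlt hw' (sub_pos.2 hεr) rfl
  refine ⟨M', ⟨⟨hM'.invol, fun a => (hM'.pos a).trans_le (hle' _ _)⟩,
    fun X hX hXr => hM'.tight X hX (htight X hX hXr)⟩, ?_⟩
  rw [hsum] at hcM
  set A := ∑ a, ∑ b, c a b * w a b
  set B := ∑ a, c a (M a)
  set C := ∑ a, c a (M' a)
  -- `M` falls short of the average, `r * B < A`, so a matching good for the remainder is good for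
  -- `w`.
  have h1 : A * (r - ε) ≤ r * C * (r - ε) := by
    nlinarith [mul_le_mul_of_nonneg_left hcM hr.le, mul_le_mul_of_nonneg_left hle.le hε.le]
  exact le_of_mul_le_mul_right h1 (sub_pos.2 hεr)

end

/-! ### Parity and bridgeless cubic graphs -/

section

variable {V : Type*} [Fintype V] [DecidableEq V]

theorem even_sum_sum {w : V → V → ℤ} (hw : ∀ a b, w a b = w b a) (hd : ∀ a, w a a = 0)
    (X : Finset V) : Even (∑ a ∈ X, ∑ b ∈ X, w a b) := by
  rw [← ZMod.intCast_eq_zero_iff_even, ← sum_product', Int.cast_sum]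
  refine sum_involution (fun p _ => p.swap) (fun p _ => ?_) (fun p _ h h' => ?_)
    (fun p hp => ?_) fun p _ => p.swap_swap
  · rw [Prod.fst_swap, Prod.snd_swap, hw p.2]
    exact CharTwo.add_self_eq_zero _
  · have : p.2 = p.1 := congrArg Prod.fst h'
    rw [this, hd] at h
    simp at h
  · rw [mem_product] at hp ⊢
    exact hp.symm

/-- The degrees in `X` sum to `#X * d`, and pairs inside `X` contribute evenly. -/
theorem odd_cut_of_odd_deg {w : V → V → ℤ} (hw : ∀ a b, w a b = w b a) (hd : ∀ a, w a a = 0)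
    {d : ℤ} (hdeg : ∀ a, ∑ b, w a b = d) (hd' : Odd d) {X : Finset V} (hX : Odd #X) :
    Odd (cut w X) := by
  have h : (∑ a ∈ X, ∑ b ∈ X, w a b) + cut w X = #X * d := by
    unfold cut
    rw [← sum_add_distrib, ← nsmul_eq_mul, ← sum_const]
    exact sum_congr rfl fun a _ => by rw [sum_add_sum_compl, hdeg]
  have h2 : Odd ((#X : ℤ) * d) := ((Int.odd_coe_nat _).2 hX).mul hd'
  rw [← h, Int.odd_add'] at h2
  exact h2.2 (even_sum_sum hw hd X)

section Graph

variable {G : SimpleGraph V}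

open scoped Classical in
/-- The adjacency function of `G`. -/
noncomputable def adj (G : SimpleGraph V) (a b : V) : ℤ := if G.Adj a b then 1 else 0

theorem adj_comm (G : SimpleGraph V) (a b : V) : adj G a b = adj G b a := by
  classical exact if_congr (G.adj_comm a b) rfl rfl

theorem adj_self (G : SimpleGraph V) (a : V) : adj G a a = 0 := by
  simp [adj]

theorem adj_nonneg (G : SimpleGraph V) (a b : V) : 0 ≤ adj G a b := by
  unfold adj; split_ifs <;> simp

theorem sum_adj_eq_ncard (G : SimpleGraph V) (a : V) :
    ∑ b, adj G a b = (G.neighborSet a).ncard := by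
  classical
  rw [Set.ncard_eq_toFinset_card']
  simp only [adj, sum_boole, Nat.cast_inj]
  congr 1
  ext
  simp

theorem sum_sum_adj (G : SimpleGraph V) : ∑ a, ∑ b, adj G a b = 2 * G.edgeSet.ncard := by
  classical
  have := G.sum_degrees_eq_twice_card_edges
  rw [Set.ncard_eq_toFinset_card']
  simp only [sum_adj_eq_ncard, Set.ncard_eq_toFinset_card']
  exact_mod_cast this

/-- The cut is odd by parity, and a single crossing edge would be a bridge. -/
theorem three_le_cut_adj (hG : IsBridgelessCubic G) {X : Finset V} (hX : Odd #X) :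
    3 ≤ cut (adj G) X := by
  have hodd : Odd (cut (adj G) X) := odd_cut_of_odd_deg (adj_comm G) (adj_self G) (d := 3)
    (fun a => by rw [sum_adj_eq_ncard, hG.cubic a]; rfl) (by decide) hX
  have hcut : cut (adj G) X = ∑ p ∈ X ×ˢ Xᶜ, adj G p.1 p.2 := by rw [cut, sum_product]
  obtain ⟨⟨a, b⟩, hp, hab⟩ : ∃ p ∈ X ×ˢ Xᶜ, adj G p.1 p.2 ≠ 0 := by
    by_contra! h
    rw [hcut, sum_eq_zero h] at hodd
    simp at hodd
  have hab : G.Adj a b := by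
    by_contra h
    simp [adj, h] at hab
  obtain ⟨ha, hb⟩ := mem_product.1 hp
  have hbr := hG.bridgeless s(a, b) hab
  rw [SimpleGraph.isBridge_iff, not_not] at hbr
  obtain ⟨q⟩ := hbr
  obtain ⟨d, -, hd1, hd2⟩ := q.exists_boundary_dart (X : Set V) ha (mem_compl.1 hb)
  have hd := d.adj
  rw [SimpleGraph.deleteEdges_adj] at hd
  have hne : (a, b) ≠ (d.fst, d.snd) := by
    intro h
    rw [Prod.mk.injEq] at h
    exact hd.2 (by simp [h.1, h.2])
  have h2 : ∑ p ∈ {(a, b), (d.fst, d.snd)}, adj G p.1 p.2 ≤ cut (adj G) X := by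
    rw [hcut]
    refine sum_le_sum_of_subset_of_nonneg ?_ fun _ _ _ => adj_nonneg G _ _
    intro p hp'
    rw [mem_insert, mem_singleton] at hp'
    rcases hp' with rfl | rfl
    · exact hp
    · exact mem_product.2 ⟨hd1, mem_compl.2 hd2⟩
  rw [sum_pair hne] at h2
  rw [show adj G a b = 1 from if_pos hab, show adj G d.fst d.snd = 1 from if_pos hd.1] at h2
  obtain ⟨k, hk⟩ := hodd
  omega

theorem isFractional_adj (hG : IsBridgelessCubic G) :
    IsFractional 3 fun a b => (adj G a b : ℝ) where
  symm a b := by rw [adj_comm]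
  nonneg a b := by exact_mod_cast adj_nonneg G a b
  diag a := by rw [adj_self, Int.cast_zero]
  deg a := by rw [← Int.cast_sum, sum_adj_eq_ncard, hG.cubic a]; norm_num
  odd_cut X hX := by rw [cut_intCast]; exact_mod_cast three_le_cut_adj hG hX

theorem isFractional_add_adj_sub (hG : IsBridgelessCubic G) {t : ℕ} {w : V → V → ℤ}
    (hw : IsFractional (2 * t + 3) fun a b => (w a b : ℝ)) (hwG : ∀ a b, 0 < w a b → G.Adj a b)
    {M : V → V} (hM : IsTightMatching (2 * t + 3) (fun a b => (w a b : ℝ)) M) :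
    IsFractional (2 * (t + 1 : ℕ) + 3)
      fun a b => ((w a b + adj G a b - graphMatrix ℤ M a b : ℤ) : ℝ) := by
  have hws : ∀ a b, w a b = w b a := fun a b => by exact_mod_cast hw.symm a b
  have hwd : ∀ a, w a a = 0 := fun a => by exact_mod_cast hw.diag a
  have hwdeg : ∀ a, ∑ b, w a b = 2 * t + 3 := fun a => by exact_mod_cast hw.deg a
  have hadj : ∀ a, G.Adj a (M a) := fun a => hwG _ _ (by exact_mod_cast hM.pos a)
  have hle : ∀ a b, graphMatrix ℤ M a b ≤ adj G a b := fun a b => by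
    unfold graphMatrix
    split_ifs with h
    · subst h
      simp [adj, hadj]
    · exact adj_nonneg G a b
  refine ⟨fun a b => ?_, fun a b => ?_, fun a => ?_, fun a => ?_, fun X hX => ?_⟩
  · rw [hws, adj_comm, graphMatrix_comm ℤ hM.invol]
  · have h1 : 0 ≤ w a b := by exact_mod_cast hw.nonneg a b
    have h2 := hle a b
    exact_mod_cast (by omega : 0 ≤ w a b + adj G a b - graphMatrix ℤ M a b)
  · simp [hwd, adj_self, graphMatrix, hM.ne hw]
  · rw [← Int.cast_sum, sum_sub_distrib, sum_add_distrib, hwdeg, sum_adj_eq_ncard, hG.cubic,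
      sum_graphMatrix]
    push_cast
    ring
  · rw [cut_intCast, cut_sub, cut_add]
    have h1 := three_le_cut_adj hG hX
    have h2 : Odd (cut w X) := odd_cut_of_odd_deg hws hwd hwdeg ⟨t + 1, by ring⟩ hX
    have h3 : 2 * t + 3 ≤ cut w X := by
      have := hw.odd_cut X hX
      rw [cut_intCast] at this
      exact_mod_cast this
    have h4 : cut (graphMatrix ℤ M) X ≤ cut (adj G) X :=
      sum_le_sum fun a _ => sum_le_sum fun b _ => hle a b
    have h5 : cut w X = 2 * t + 3 → cut (graphMatrix ℤ M) X = 1 := by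
      intro h
      have := hM.tight X hX (by rw [cut_intCast, h]; push_cast; ring)
      rw [cut_graphMatrix] at this ⊢
      exact_mod_cast this
    have key : 2 * ((t + 1 : ℕ) : ℤ) + 3 ≤
        cut w X + cut (adj G) X - cut (graphMatrix ℤ M) X := by
      obtain ⟨k, hk⟩ := h2
      push_cast
      -- A tight cut gains at least 3 and loses 1. A slack one, being odd, is already at least `2t +
      -- 5`, and `M` removes no more than `G` adds.
      by_cases h : cut w X = 2 * t + 3
      · have := h5 h
        omega
      · omega
    exact_mod_cast key

open scoped Classical in
/-- The indicator of the pairs of adjacent vertices not matched by any of the `M i`. -/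
noncomputable def uncovered (G : SimpleGraph V) {t : ℕ} (M : Fin t → V → V) (a b : V) : ℝ :=
  if G.Adj a b ∧ ∀ i, M i a ≠ b then 1 else 0

theorem uncovered_cons {t : ℕ} (M : Fin t → V → V) (N : V → V) (a b : V) :
    uncovered G (Fin.cons N M : Fin (t + 1) → V → V) a b =
      uncovered G M a b - if N a = b then uncovered G M a b else 0 := by
  unfold uncovered
  by_cases h1 : G.Adj a b <;> by_cases h2 : N a = b <;> simp [h1, h2, Fin.forall_fin_succ]

theorem exists_family (hG : IsBridgelessCubic G) (t : ℕ) : ∃ M : Fin t → V → V,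
    (∀ i a, M i (M i a) = a) ∧ (∀ i a, G.Adj a (M i a)) ∧
    IsFractional (2 * t + 3)
      (fun a b => (((t + 1) * adj G a b - ∑ i, graphMatrix ℤ (M i) a b : ℤ) : ℝ)) ∧
    ∑ a, ∑ b, uncovered G M a b ≤ (1 - CubicCover.a t) * (2 * G.edgeSet.ncard) := by
  have := hG.connected.nonempty
  induction t with
  | zero =>
    refine ⟨fun _ => id, fun i => i.elim0, fun i => i.elim0, ?_, ?_⟩
    · simpa using isFractional_adj hG
    · have h : ∀ a b, uncovered G (fun _ => id : Fin 0 → V → V) a b = adj G a b := fun a b => by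
        by_cases h : G.Adj a b <;> simp [uncovered, adj, h]
      simp only [h, CubicCover.a, sub_zero, one_mul]
      exact_mod_cast (sum_sum_adj G).le
  | succ t ih =>
    obtain ⟨M, hM1, hM2, hw, hunc⟩ := ih
    set w : V → V → ℤ := fun a b => (t + 1) * adj G a b - ∑ i, graphMatrix ℤ (M i) a b with hwdef
    have hwG : ∀ a b, 0 < w a b → G.Adj a b := by
      intro a b h
      by_contra hab
      have h1 : 0 ≤ ∑ i, graphMatrix ℤ (M i) a b :=
        sum_nonneg fun i _ => by unfold graphMatrix; split_ifs <;> simp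
      simp only [hwdef, adj, hab, if_false] at h
      omega
    obtain ⟨N, hN, hNle⟩ := exists_tightMatching_le (uncovered G M) hw (by positivity)
    refine ⟨Fin.cons N M, ?_, ?_, ?_, ?_⟩
    · rw [Fin.forall_fin_succ]
      exact ⟨hN.invol, hM1⟩
    · rw [Fin.forall_fin_succ]
      exact ⟨fun a => hwG _ _ (by exact_mod_cast hN.pos a), hM2⟩
    · refine Eq.subst (motive := IsFractional _) ?_ (isFractional_add_adj_sub hG hw hwG hN)
      funext a b
      rw [Int.cast_inj, Fin.sum_univ_succ]
      simp only [Fin.cons_zero, Fin.cons_succ]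
      push_cast
      ring
    -- No earlier matching contributes on an uncovered edge, so `w` equals `t + 1` there.
    · have h1 : ∑ a, ∑ b, uncovered G M a b * (w a b : ℝ) =
          (t + 1) * ∑ a, ∑ b, uncovered G M a b := by
        simp only [mul_sum]
        refine sum_congr rfl fun a _ => sum_congr rfl fun b _ => ?_
        unfold uncovered
        split_ifs with h
        · simp [hwdef, adj, graphMatrix, h.1, h.2]
        · simp
      have h2 : ∑ a, ∑ b, uncovered G (Fin.cons N M : Fin (t + 1) → V → V) a b =
          ∑ a, ∑ b, uncovered G M a b - ∑ a, uncovered G M a (N a) := by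
        simp [uncovered_cons, sum_sub_distrib]
      have h3 : (1 - CubicCover.a (t + 1)) = (1 - CubicCover.a t) * (t + 2) / (2 * t + 3) := by
        have : (2 * (t : ℝ) + 3) ≠ 0 := by positivity
        have h' : (2 * ((t : ℝ) + 1) + 1) ≠ 0 := by positivity
        simp only [CubicCover.a]
        push_cast
        field_simp
        ring
      rw [h1] at hNle
      rw [h2, h3, div_mul_eq_mul_div, le_div_iff₀ (by positivity)]
      nlinarith

end Graph

end

/-! ### From involutions to perfect matchings of the graph -/

/-- The subgraph of matched pairs of an involution along edges. -/
def matchingSubgraph {V : Type*} {G : SimpleGraph V} {M : V → V} (hM : ∀ a, M (M a) = a)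
    (hG : ∀ a, G.Adj a (M a)) : G.Subgraph where
  verts := Set.univ
  Adj a b := M a = b
  adj_sub := by rintro a b rfl; exact hG a
  edge_vert _ := Set.mem_univ _
  symm := ⟨by rintro a b rfl; exact hM a⟩

theorem matchingSubgraph_isPerfectMatching {V : Type*} {G : SimpleGraph V} {M : V → V}
    (hM : ∀ a, M (M a) = a) (hG : ∀ a, G.Adj a (M a)) :
    (matchingSubgraph hM hG).IsPerfectMatching :=
  ⟨fun a _ => ⟨M a, rfl, fun _ h => Eq.symm h⟩, fun a => Set.mem_univ a⟩

theorem exists_perfectMatchings {V : Type*} [Finite V] {G : SimpleGraph V}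
    (hG : IsBridgelessCubic G) (t : ℕ) : ∃ M : Fin t → G.Subgraph,
      (∀ i, (M i).IsPerfectMatching) ∧ a t ≤ coveredFraction M := by
  classical
  have := Fintype.ofFinite V
  obtain ⟨M, hM, hMG, -, hunc⟩ := exists_family hG t
  refine ⟨fun i => matchingSubgraph (hM i) (hMG i),
    fun i => matchingSubgraph_isPerfectMatching _ _, ?_⟩
  -- The union of the matchings as a graph, so that the handshake identity counts covered edges.
  let H : SimpleGraph V :=
    { Adj a b := ∃ i, M i a = b
      symm := ⟨by rintro a b ⟨i, rfl⟩; exact ⟨i, hM i a⟩⟩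
      loopless := ⟨by rintro a ⟨i, h⟩; exact (hMG i a).ne' h⟩ }
  have hH : (⋃ i, (matchingSubgraph (hM i) (hMG i)).edgeSet) = H.edgeSet := by
    ext e
    induction e with
    | _ a b => simp [H, matchingSubgraph]
  have hcov : ∑ a, ∑ b, uncovered G M a b = 2 * G.edgeSet.ncard - 2 * H.edgeSet.ncard := by
    have h1 := sum_sum_adj G
    have h2 := sum_sum_adj H
    have h3 : ∀ a b, uncovered G M a b = ((adj G a b - adj H a b : ℤ) : ℝ) := by
      intro a b
      by_cases h : ∃ i, M i a = b
      · obtain ⟨i, rfl⟩ := h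
        have hG' := hMG i a
        have hH' : H.Adj a (M i a) := ⟨i, rfl⟩
        simp [uncovered, adj, hG', hH']
      · have hH' : ¬ H.Adj a b := h
        push Not at h
        simp [uncovered, adj, h, hH']
    simp only [h3, ← Int.cast_sum, sum_sub_distrib, h1, h2]
    push_cast
    ring
  have hpos : 0 < (G.edgeSet.ncard : ℝ) := by
    obtain ⟨v⟩ := hG.connected.nonempty
    have h := hG.cubic v
    obtain ⟨u, hu⟩ : (G.neighborSet v).Nonempty := Set.nonempty_of_ncard_ne_zero (by omega)
    have : (G.edgeSet).Nonempty := ⟨s(v, u), hu⟩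
    exact_mod_cast (Set.ncard_pos).2 this
  unfold coveredFraction
  rw [hH, le_div_iff₀ hpos]
  linarith

theorem coveredFraction_le_one {V : Type*} [Finite V] {G : SimpleGraph V} {t : ℕ}
    (M : Fin t → G.Subgraph) : coveredFraction M ≤ 1 := by
  refine div_le_one_of_le₀ ?_ (Nat.cast_nonneg _)
  exact_mod_cast Set.ncard_le_ncard (Set.iUnion_subset fun i => (M i).edgeSet_subset)

theorem a_le_maxFraction {V : Type*} [Finite V] {G : SimpleGraph V} (hG : IsBridgelessCubic G)
    (t : ℕ) : a t ≤ maxFraction G t := by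
  obtain ⟨M, hM, h⟩ := exists_perfectMatchings hG t
  refine h.trans (le_csSup ⟨1, ?_⟩ ⟨M, hM, rfl⟩)
  rintro _ ⟨M, -, rfl⟩
  exact coveredFraction_le_one M

/-- Bounding `m t` below by `le_csInf` needs the class of graphs to be nonempty. -/
theorem isBridgelessCubic_completeGraph : IsBridgelessCubic (⊤ : SimpleGraph (Fin 4)) where
  connected := SimpleGraph.connected_top
  cubic v := by
    have : (⊤ : SimpleGraph (Fin 4)).neighborSet v = (({v}ᶜ : Finset (Fin 4)) : Set (Fin 4)) := by
      ext; simp [eq_comm]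
    rw [this, Set.ncard_coe_finset, card_compl]
    rfl
  bridgeless e he := by
    induction e with
    | _ x y =>
      have hxy : x ≠ y := he
      obtain ⟨z, hzx, hzy⟩ : ∃ z : Fin 4, z ≠ x ∧ z ≠ y := by
        clear he hxy
        revert x y
        decide
      rw [SimpleGraph.isBridge_iff, not_not]
      -- The detour through `z` avoids the deleted edge.
      refine (SimpleGraph.Adj.reachable (v := z) ?_).trans (SimpleGraph.Adj.reachable ?_)
      · simp [SimpleGraph.deleteEdges_adj, hzx.symm, hzy, hxy]
      · simp [SimpleGraph.deleteEdges_adj, hzx, hzy, hxy.symm]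

end CubicCover


theorem theorem3p1 (t : ℕ) :
    CubicCover.a t ≤ CubicCover.m t ∧
      ∀ (V : Type*) [Finite V] (G : SimpleGraph V), CubicCover.IsBridgelessCubic G →
        ∃ M : Fin t → G.Subgraph, (∀ i, (M i).IsPerfectMatching) ∧
          CubicCover.a t ≤ CubicCover.coveredFraction M := by
  refine ⟨le_csInf ⟨_, Fin 4, inferInstance, ⊤, CubicCover.isBridgelessCubic_completeGraph, rfl⟩ ?_,
    fun V _ G hG => CubicCover.exists_perfectMatchings hG t⟩
  rintro _ ⟨V, _, G, hG, rfl⟩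
  exact CubicCover.a_le_maxFraction hG t
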